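/- Let $\mathbb{D}=\{z\in\mathbb{C}:|z|<1\}$, and let $\mathcal{S}$ be the class of functions $f(z)=z+a_2z^2+a_3z^3+\cdots$ that are holomorphic and injective in $\mathbb{D}$. For holomorphic $g,h$ in $\mathbb{D}$ write $g\prec h$ if there is a holomorphic $\omega$ on $\mathbb{D}$ with $\omega(0)=0$, $|\omega(z)|<1$ and $g(z)=h(\omega(z))$ for all $z\in\mathbb{D}$. Let $$\mathcal{BT}_{\mathfrak B}=\{f\in\mathcal{S}: f'(z)\prec \sqrt{1+\tanh z}\}$$ (principal branch of the square root). The logarithmic coefficients $\gamma_n=\gamma_n(f)$ of $f\in\mathcal{S}$ are defined by $$\log\frac{f(z)}{z}=2\sum_{n=1}^{\infty}\gamma_n z^n,\qquad z\in\mathbb{D},\quad \log 1:=0 .$$ If $f\in\mathcal{BT}_{\mathfrak B}$, then the logarithmic coefficients of $f$ exist, the first four are given by $$\gamma_1=\tfrac12a_2,\quad \gamma_2=\tfrac12\left(a_3-\tfrac12a_2^2\right),\quad \gamma_3=\tfrac12\left(a_4-a_2a_3+\tfrac13a_2^3\right),\quad \gamma_4=\tfrac12\left(a_5-a_2a_4+a_2^2a_3-\tfrac12a_3^2-\tfrac14a_2^4\right),$$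 and $$|\gamma_n|\le\frac{1}{4(n+1)}\qquad\text{for } n=1,2,3,4.$$ The inequalities are sharp: for each $n\in\{1,2,3,4\}$ the function $$f_n(z)=\int_0^z\sqrt{1+\tanh (t^n)}\,dt$$ belongs to $\mathcal{BT}_{\mathfrak B}$ and satisfies $|\gamma_n(f_n)|=\frac{1}{4(n+1)}$. Moreover, as $z\to0$, $$f_1(z)=z+\frac{z^2}{4}-\frac{z^3}{24}-\frac{5z^4}{192}+\frac{17z^5}{1920}+O(z^6),\qquad f_2(z)=z+\frac{z^3}{6}-\frac{z^5}{40}-\frac{5z^7}{336}+O(z^9),$$ $$f_3(z)=z+\frac{z^4}{8}-\frac{z^7}{56}+O(z^{10}),\qquad f_4(z)=z+\frac{z^5}{10}-\frac{z^9}{72}+O(z^{13}).$$ -/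

import Mathlib

open scoped Topology Asymptotics

namespace BoundedTurning

/-- The open unit disk. -/
def unitDisk : Set ℂ := Metric.ball 0 1

/-- The class of functions holomorphic and univalent (injective) in the unit disk
with `f 0 = 0` and `f' 0 = 1`. -/
def ClassS : Set (ℂ → ℂ) :=
  {f | DifferentiableOn ℂ f unitDisk ∧ f 0 = 0 ∧ deriv f 0 = 1 ∧ Set.InjOn f unitDisk}

/-- Subordination `f ≺ g` in the unit disk, for `f` and `g` holomorphic there. -/
def Subordinate (f g : ℂ → ℂ) : Prop :=
  ∃ ω : ℂ → ℂ, DifferentiableOn ℂ ω unitDisk ∧ ω 0 = 0 ∧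
    (∀ z ∈ unitDisk, ‖ω z‖ < 1) ∧ ∀ z ∈ unitDisk, f z = g (ω z)

/-- The function `√(1 + tanh z)`, with the principal branch of the square root. On the unit disk
`1 + tanh z = 2 / (1 + exp (-2z))` avoids the nonpositive reals, so it is holomorphic there. -/
noncomputable def bean (z : ℂ) : ℂ := (1 + Complex.tanh z) ^ (1 / 2 : ℂ)

/-- The univalent functions whose derivative is subordinate to `√(1 + tanh z)`. -/
def ClassBT : Set (ℂ → ℂ) := {f | f ∈ ClassS ∧ Subordinate (deriv f) bean}

/-- The `n`-th Taylor coefficient of `f` at `0`. -/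
noncomputable def taylorCoeff (f : ℂ → ℂ) (n : ℕ) : ℂ := iteratedDeriv n f 0 / (n.factorial : ℂ)

/-- `γ 1, γ 2, …` are the logarithmic coefficients of `f`: in the unit disk,
`log (f z / z) = 2 * ∑_{n ≥ 1} γ n * z ^ n`, where the left-hand side is the holomorphic branch `F`
of the logarithm with `F 0 = log 1 = 0`. The value `γ 0` plays no role. -/
def IsLogCoeffs (f : ℂ → ℂ) (γ : ℕ → ℂ) : Prop :=
  ∃ F : ℂ → ℂ, DifferentiableOn ℂ F unitDisk ∧ F 0 = 0 ∧
    (∀ z ∈ unitDisk, z ≠ 0 → Complex.exp (F z) = f z / z) ∧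
    ∀ z ∈ unitDisk, HasSum (fun k : ℕ => 2 * (γ (k + 1) * z ^ (k + 1))) (F z)

/-- `f_n z = ∫_0^z √(1 + tanh (t ^ n)) dt`, integrated along the segment `t = s z`, `0 ≤ s ≤ 1`. -/
noncomputable def extremal (n : ℕ) (z : ℂ) : ℂ :=
  ∫ s in (0 : ℝ)..1, bean (((s : ℂ) * z) ^ n) * z

end BoundedTurning

namespace BoundedTurning

/-! Write f' = √(1 + tanh ω) with ω = Σ wₖ zᵏ a Schwarz function. Two differential equations turn
the problem into algebra: p = √(1 + tanh ω) satisfies 2p' = ω' p (2 - p²), and G = f(z)/z = exp F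
satisfies G' = F' G. Comparing coefficients gives, for n ≤ 4, γₙ = (wₙ + nonlinear terms in w₁, …,
wₙ₋₁) / (4(n+1)), see `IsLogCoeffs.eq_of_deriv_eq_bean_comp`. The bound says that the bracket has
modulus at most 1.

By the Schwarz lemma ω = zφ with |φ| ≤ 1, and three Schur steps express w₁, …, w₄ through numbers
c₁, …, c₄ of the closed disk (`exists_schur_parameters`). After the triangle inequality only real
inequalities in |c₁|, |c₂|, |c₃| remain: `cubic_majorant_le_one` for n = 3 and
`quartic_majorant_le_one` for n = 4; the cases n = 1, 2 are immediate.

For ω = zⁿ the nonlinear terms vanish, which gives sharpness. The extremal functions are univalent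
because their derivative has positive real part, and their expansions come from integrating that of
√(1 + tanh) at zⁿ. -/

/-! ### Taylor coefficients as formal power series -/

/-- The Taylor series of `f` at `0`, as a formal power series. -/
noncomputable def taylorSeries (f : ℂ → ℂ) : PowerSeries ℂ := PowerSeries.mk (taylorCoeff f)

@[simp] theorem coeff_taylorSeries (f : ℂ → ℂ) (n : ℕ) :
    PowerSeries.coeff n (taylorSeries f) = taylorCoeff f n := PowerSeries.coeff_mk _ _

theorem taylorCoeff_zero (f : ℂ → ℂ) : taylorCoeff f 0 = f 0 := by simp [taylorCoeff]

theorem taylorSeries_congr {f g : ℂ → ℂ} (h : f =ᶠ[𝓝 0] g) : taylorSeries f = taylorSeries g := by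
  ext n
  simp [taylorCoeff, h.iteratedDeriv_eq n]

theorem taylorSeries_congr_of_eqOn {f g : ℂ → ℂ} (h : Set.EqOn f g unitDisk) :
    taylorSeries f = taylorSeries g :=
  taylorSeries_congr (h.eventuallyEq_of_mem (Metric.ball_mem_nhds 0 one_pos))

theorem taylorSeries_add {f g : ℂ → ℂ} (hf : AnalyticAt ℂ f 0) (hg : AnalyticAt ℂ g 0) :
    taylorSeries (fun z => f z + g z) = taylorSeries f + taylorSeries g := by
  ext n
  have := iteratedDeriv_add (n := n) hf.contDiffAt hg.contDiffAt
  simp only [coeff_taylorSeries, map_add, taylorCoeff]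
  rw [show (fun z => f z + g z) = f + g from rfl, this, add_div]

theorem taylorSeries_sub {f g : ℂ → ℂ} (hf : AnalyticAt ℂ f 0) (hg : AnalyticAt ℂ g 0) :
    taylorSeries (fun z => f z - g z) = taylorSeries f - taylorSeries g := by
  ext n
  have := iteratedDeriv_sub (n := n) hf.contDiffAt hg.contDiffAt
  simp only [coeff_taylorSeries, map_sub, taylorCoeff]
  rw [show (fun z => f z - g z) = f - g from rfl, this, sub_div]

theorem taylorSeries_mul {f g : ℂ → ℂ} (hf : AnalyticAt ℂ f 0) (hg : AnalyticAt ℂ g 0) :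
    taylorSeries (fun z => f z * g z) = taylorSeries f * taylorSeries g := by
  ext n
  have := iteratedDeriv_mul (n := n) hf.contDiffAt hg.contDiffAt
  rw [PowerSeries.coeff_mul, Finset.Nat.sum_antidiagonal_eq_sum_range_succ_mk]
  simp only [coeff_taylorSeries, taylorCoeff]
  rw [show (fun z => f z * g z) = f * g from rfl, this, Finset.sum_div]
  refine Finset.sum_congr rfl fun i hi => ?_
  have hi' : i ≤ n := Nat.lt_succ_iff.1 (Finset.mem_range.1 hi)
  rw [Nat.cast_choose ℂ hi']
  have h1 : (n.factorial : ℂ) ≠ 0 := by exact_mod_cast n.factorial_ne_zero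
  have h2 : (i.factorial : ℂ) ≠ 0 := by exact_mod_cast i.factorial_ne_zero
  have h3 : ((n - i).factorial : ℂ) ≠ 0 := by exact_mod_cast (n - i).factorial_ne_zero
  field_simp

theorem taylorSeries_const (c : ℂ) : taylorSeries (fun _ => c) = PowerSeries.C c := by
  ext n
  rw [coeff_taylorSeries, taylorCoeff, iteratedDeriv_const, PowerSeries.coeff_C]
  split_ifs with h <;> simp [h]

theorem taylorSeries_id : taylorSeries (fun z => z) = PowerSeries.X := by
  ext n
  rw [coeff_taylorSeries, taylorCoeff, PowerSeries.coeff_X]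
  match n with
  | 0 => simp
  | 1 => simp
  | n + 2 =>
    rw [iteratedDeriv_succ']
    simp [iteratedDeriv_const]

theorem taylorSeries_pow_id (n : ℕ) : taylorSeries (fun z => z ^ n) = PowerSeries.X ^ n := by
  induction n with
  | zero => simpa using taylorSeries_const 1
  | succ n ih =>
    simp_rw [pow_succ]
    rw [taylorSeries_mul (by fun_prop) (by fun_prop), ih, taylorSeries_id]

theorem taylorCoeff_deriv (f : ℂ → ℂ) (n : ℕ) :
    taylorCoeff (deriv f) n = (n + 1) * taylorCoeff f (n + 1) := by
  rw [taylorCoeff, taylorCoeff, iteratedDeriv_succ', Nat.factorial_succ]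
  have h1 : (n.factorial : ℂ) ≠ 0 := by exact_mod_cast n.factorial_ne_zero
  have h2 : (n : ℂ) + 1 ≠ 0 := by exact_mod_cast n.succ_ne_zero
  push_cast
  field_simp

theorem isOpen_unitDisk : IsOpen unitDisk := Metric.isOpen_ball

theorem mem_unitDisk {z : ℂ} : z ∈ unitDisk ↔ ‖z‖ < 1 := by simp [unitDisk]

theorem zero_mem_unitDisk : (0 : ℂ) ∈ unitDisk := by simp [unitDisk]

theorem unitDisk_mem_nhds : unitDisk ∈ 𝓝 (0 : ℂ) := isOpen_unitDisk.mem_nhds zero_mem_unitDisk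

theorem analyticAt_zero {f : ℂ → ℂ} (hf : DifferentiableOn ℂ f unitDisk) : AnalyticAt ℂ f 0 :=
  hf.analyticAt unitDisk_mem_nhds

theorem hasSum_taylorCoeff {f : ℂ → ℂ} (hf : DifferentiableOn ℂ f unitDisk) {z : ℂ}
    (hz : z ∈ unitDisk) : HasSum (fun n => taylorCoeff f n * z ^ n) (f z) := by
  have e : (fun n => taylorCoeff f n * z ^ n) =
      fun n => (n.factorial : ℂ)⁻¹ • (z - 0) ^ n • iteratedDeriv n f 0 := by
    ext n
    simp only [taylorCoeff, sub_zero, smul_eq_mul]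
    ring
  rw [e]
  exact Complex.hasSum_taylorSeries_on_ball hf hz

theorem taylorCoeff_eq_of_hasSum {f : ℂ → ℂ} {c : ℕ → ℂ}
    (h : ∀ z ∈ unitDisk, HasSum (fun n => c n * z ^ n) (f z)) : taylorCoeff f = c := by
  have h1 : HasFPowerSeriesAt f (FormalMultilinearSeries.ofScalars ℂ c) 0 := by
    rw [hasFPowerSeriesAt_iff']
    filter_upwards [unitDisk_mem_nhds] with z hz
    simpa [FormalMultilinearSeries.coeff_ofScalars, mul_comm] using h z hz
  have h2 := h1.analyticAt.hasFPowerSeriesAt.eq_formalMultilinearSeries h1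
  ext n
  simpa [FormalMultilinearSeries.coeff_ofScalars, taylorCoeff] using
    congrArg (fun p => FormalMultilinearSeries.coeff p n) h2

/-- A function analytic at `0` is `O(z ^ n)` if its first `n` Taylor coefficients vanish. -/
theorem isBigO_pow_of_taylorCoeff_eq_zero {f : ℂ → ℂ} (hf : AnalyticAt ℂ f 0) {n : ℕ}
    (h : ∀ k < n, taylorCoeff f k = 0) : f =O[𝓝 0] fun z => z ^ n := by
  have h1 : (n : ℕ∞) ≤ analyticOrderAt f 0 := by
    rw [natCast_le_analyticOrderAt_iff_iteratedDeriv_eq_zero hf]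
    intro k hk
    have := h k hk
    rw [taylorCoeff, div_eq_zero_iff] at this
    exact this.resolve_right (by exact_mod_cast k.factorial_ne_zero)
  obtain ⟨g, hg, hfg⟩ := (natCast_le_analyticOrderAt hf).1 h1
  have h2 : f =ᶠ[𝓝 0] fun z => z ^ n * g z := by
    filter_upwards [hfg] with z hz
    simpa using hz
  refine h2.trans_isBigO ?_
  simpa using (Asymptotics.isBigO_refl (fun z : ℂ => z ^ n) (𝓝 0)).mul
    (hg.continuousAt.norm.isBoundedUnder_le.isBigO_one ℂ)

/-! ### The function √(1 + tanh z) on the unit disk -/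

/-- For real z the value is a positive real; otherwise 0 < |2 Im z| < 2 < π, so the sine in the
imaginary part does not vanish. -/
theorem one_add_exp_mem_slitPlane {z : ℂ} (hz : z ∈ unitDisk) :
    1 + Complex.exp (-2 * z) ∈ Complex.slitPlane := by
  have him : |z.im| < 1 := (Complex.abs_im_le_norm z).trans_lt (mem_unitDisk.1 hz)
  rw [abs_lt] at him
  have hpi := Real.pi_gt_three
  rw [Complex.mem_slitPlane_iff]
  by_cases h0 : z.im = 0
  · left
    simp only [Complex.add_re, Complex.one_re, Complex.exp_re]
    simp [h0]
    positivity
  · right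
    simp only [Complex.add_im, Complex.one_im, Complex.exp_im, zero_add]
    refine mul_ne_zero (Real.exp_pos _).ne' ?_
    have : (-2 * z).im = -2 * z.im := by simp
    rw [this, Ne, Real.sin_eq_zero_iff_of_lt_of_lt (by linarith) (by linarith)]
    simpa using h0

theorem one_add_tanh_eq {z : ℂ} (hz : z ∈ unitDisk) :
    1 + Complex.tanh z = 2 / (1 + Complex.exp (-2 * z)) := by
  have h1 : 1 + Complex.exp (-2 * z) ≠ 0 :=
    Complex.slitPlane_ne_zero (one_add_exp_mem_slitPlane hz)
  have h2 : Complex.exp (-2 * z) = Complex.exp (-z) * Complex.exp (-z) := by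
    rw [← Complex.exp_add]; ring_nf
  have h3 : Complex.exp z * Complex.exp (-z) = 1 := by rw [← Complex.exp_add]; simp
  have h4 : Complex.exp z + Complex.exp (-z) = Complex.exp z * (1 + Complex.exp (-2 * z)) := by
    rw [h2]; linear_combination (-Complex.exp (-z)) * h3
  have h5 : Complex.exp z + Complex.exp (-z) ≠ 0 := by
    rw [h4]; exact mul_ne_zero (Complex.exp_ne_zero _) h1
  rw [Complex.tanh_eq_sinh_div_cosh, Complex.sinh, Complex.cosh]
  rw [div_div_div_cancel_right₀ two_ne_zero, one_add_div h5, div_eq_div_iff h5 h1]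
  linear_combination (2 : ℂ) * -h4

/-- Inversion and multiplication by 2 preserve the slit plane. -/
theorem one_add_tanh_mem_slitPlane {z : ℂ} (hz : z ∈ unitDisk) :
    1 + Complex.tanh z ∈ Complex.slitPlane := by
  have h := one_add_exp_mem_slitPlane hz
  have h0 := Complex.slitPlane_ne_zero h
  rw [one_add_tanh_eq hz, div_eq_mul_inv, Complex.mem_slitPlane_iff]
  rw [Complex.mem_slitPlane_iff] at h
  have hn : 0 < Complex.normSq (1 + Complex.exp (-2 * z)) := Complex.normSq_pos.2 h0
  refine h.imp (fun h => ?_) fun h => ?_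
  · rw [← Complex.ofReal_ofNat, Complex.re_ofReal_mul, Complex.inv_re]
    positivity
  · rw [← Complex.ofReal_ofNat, Complex.im_ofReal_mul, Complex.inv_im]
    exact mul_ne_zero two_ne_zero (div_ne_zero (neg_ne_zero.2 h) hn.ne')

theorem bean_sq (z : ℂ) : bean z ^ 2 = 1 + Complex.tanh z := by
  simp [bean]

theorem bean_zero : bean 0 = 1 := by simp [bean]

/-- The principal root halves the argument, which lands in (-π/2, π/2). -/
theorem re_cpow_half_pos {w : ℂ} (hw : w ∈ Complex.slitPlane) : 0 < (w ^ (1 / 2 : ℂ)).re := by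
  rw [Complex.cpow_def_of_ne_zero (Complex.slitPlane_ne_zero hw), Complex.exp_re]
  refine mul_pos (Real.exp_pos _) (Real.cos_pos_of_mem_Ioo ?_)
  have h1 : (Complex.log w * (1 / 2)).im = w.arg / 2 := by
    rw [show (1 / 2 : ℂ) = ((1 / 2 : ℝ) : ℂ) by norm_num, Complex.im_mul_ofReal, Complex.log_im]
    ring
  have h2 := Complex.neg_pi_lt_arg w
  have h3 := lt_of_le_of_ne (Complex.arg_le_pi w) (Complex.slitPlane_arg_ne_pi hw)
  rw [h1]
  constructor <;> linarith

theorem bean_re_pos {z : ℂ} (hz : z ∈ unitDisk) : 0 < (bean z).re :=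
  re_cpow_half_pos (one_add_tanh_mem_slitPlane hz)

/-- With q = 1 + tanh z one has q' = 1 - tanh² z = q (2 - q). The derivative is put in a form
polynomial in `bean`, so that Taylor coefficients follow by recursion. -/
theorem hasDerivAt_bean {z : ℂ} (hz : z ∈ unitDisk) :
    HasDerivAt bean (bean z * (2 - bean z ^ 2) / 2) z := by
  have h0 : 1 + Complex.exp (-2 * z) ≠ 0 :=
    Complex.slitPlane_ne_zero (one_add_exp_mem_slitPlane hz)
  have hq0 := Complex.slitPlane_ne_zero (one_add_tanh_mem_slitPlane hz)
  have h1 : HasDerivAt (fun z => 2 / (1 + Complex.exp (-2 * z)))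
      ((1 + Complex.tanh z) * (2 - (1 + Complex.tanh z))) z := by
    have h2 : HasDerivAt (fun z : ℂ => Complex.exp (-2 * z)) (Complex.exp (-2 * z) * -2) z := by
      simpa using ((hasDerivAt_id z).const_mul (-2 : ℂ)).cexp
    refine ((hasDerivAt_const z (2 : ℂ)).fun_div (h2.const_add 1) h0).congr_deriv ?_
    rw [one_add_tanh_eq hz]
    generalize Complex.exp (-2 * z) = E at h0
    field_simp
    ring
  have h2 : HasDerivAt (fun z => 1 + Complex.tanh z)
      ((1 + Complex.tanh z) * (2 - (1 + Complex.tanh z))) z := by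
    refine h1.congr_of_eventuallyEq ?_
    filter_upwards [isOpen_unitDisk.mem_nhds hz] with w hw using one_add_tanh_eq hw
  have h3 := h2.cpow_const (c := 1 / 2) (one_add_tanh_mem_slitPlane hz)
  refine h3.congr_deriv ?_
  rw [bean_sq, Complex.cpow_sub _ _ hq0, Complex.cpow_one, bean]
  field_simp

theorem differentiableOn_bean : DifferentiableOn ℂ bean unitDisk :=
  fun _ hz => (hasDerivAt_bean hz).differentiableAt.differentiableWithinAt

/-! ### The Schur algorithm -/

/-- One step of the Schur algorithm. -/
theorem exists_schur_step {φ : ℂ → ℂ} (hφ : DifferentiableOn ℂ φ unitDisk)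
    (hb : ∀ z ∈ unitDisk, ‖φ z‖ ≤ 1) :
    ∃ ψ : ℂ → ℂ, DifferentiableOn ℂ ψ unitDisk ∧ (∀ z ∈ unitDisk, ‖ψ z‖ ≤ 1) ∧
      ∀ z ∈ unitDisk, φ z * (1 + starRingEnd ℂ (φ 0) * (z * ψ z)) = φ 0 + z * ψ z := by
  -- If |φ(0)| = 1, the maximum principle makes φ constant and ψ = 0 works. Otherwise move φ(0) to 0
  -- by a disk automorphism and divide by z, using the Schwarz lemma.
  rcases (hb 0 zero_mem_unitDisk).eq_or_lt with h1 | h1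
  · refine ⟨fun _ => 0, differentiableOn_const 0, by simp, fun z hz => ?_⟩
    have hmax : IsMaxOn (norm ∘ φ) unitDisk 0 := fun w hw => by
      simpa [h1] using hb w hw
    simpa using Complex.eqOn_of_isPreconnected_of_isMaxOn_norm
      (convex_ball (0 : ℂ) 1).isPreconnected isOpen_unitDisk hφ zero_mem_unitDisk hmax hz
  set c := φ 0 with hc
  have hden : ∀ z ∈ unitDisk, 1 - starRingEnd ℂ c * φ z ≠ 0 := by
    intro z hz h
    have h2 : ‖starRingEnd ℂ c * φ z‖ = 1 := by rw [← sub_eq_zero.1 h, norm_one]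
    rw [norm_mul, RCLike.norm_conj] at h2
    nlinarith [hb z hz, norm_nonneg c, norm_nonneg (φ z)]
  set g : ℂ → ℂ := fun z => (φ z - c) / (1 - starRingEnd ℂ c * φ z) with hg
  have hgd : DifferentiableOn ℂ g unitDisk :=
    (hφ.sub_const c).fun_div ((hφ.const_mul _).const_sub 1) hden
  have hg0 : g 0 = 0 := by simp [hg, hc]
  have hgb : ∀ z ∈ unitDisk, ‖g z‖ ≤ 1 := by
    intro z hz
    rw [hg, norm_div, div_le_one (norm_pos_iff.2 (hden z hz))]
    rw [← sq_le_sq₀ (norm_nonneg _) (norm_nonneg _), ← Complex.normSq_eq_norm_sq,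
      ← Complex.normSq_eq_norm_sq]
    have h3 : Complex.normSq (1 - starRingEnd ℂ c * φ z) - Complex.normSq (φ z - c)
        = (1 - Complex.normSq c) * (1 - Complex.normSq (φ z)) := by
      simp only [Complex.normSq_apply, Complex.sub_re, Complex.sub_im, Complex.mul_re,
        Complex.mul_im, Complex.conj_re, Complex.conj_im, Complex.one_re, Complex.one_im]
      ring
    have h4 : 0 ≤ 1 - Complex.normSq c := by
      rw [Complex.normSq_eq_norm_sq]; nlinarith [norm_nonneg c]
    have h5 : 0 ≤ 1 - Complex.normSq (φ z) := by
      rw [Complex.normSq_eq_norm_sq]; nlinarith [norm_nonneg (φ z), hb z hz]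
    nlinarith [mul_nonneg h4 h5]
  refine ⟨dslope g 0, (Complex.differentiableOn_dslope unitDisk_mem_nhds).2 hgd, fun z hz => ?_,
    fun z hz => ?_⟩
  · simpa using Complex.norm_dslope_le_div_of_mapsTo_ball (R₂ := 1) hgd
      (fun w hw => by simpa [hg0] using hgb w hw) hz
  · have h6 : z * dslope g 0 z = g z := by
      simpa [hg0] using sub_smul_dslope g 0 z
    have h7 : g z * (1 - starRingEnd ℂ c * φ z) = φ z - c := div_mul_cancel₀ _ (hden z hz)
    rw [h6]
    linear_combination -h7

theorem coeff_mul_eq_sum_range (a b : PowerSeries ℂ) (n : ℕ) :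
    PowerSeries.coeff n (a * b) =
      ∑ i ∈ Finset.range (n + 1), PowerSeries.coeff i a * PowerSeries.coeff (n - i) b := by
  rw [PowerSeries.coeff_mul, Finset.Nat.sum_antidiagonal_eq_sum_range_succ_mk]

/-- Compare coefficients of zⁿ⁺¹ in the division-free Schur relation; the constant φ(0) on the right
drops out. -/
theorem schur_step_coeffs {φ ψ : ℂ → ℂ} (hφ : DifferentiableOn ℂ φ unitDisk)
    (hψ : DifferentiableOn ℂ ψ unitDisk)
    (h : ∀ z ∈ unitDisk, φ z * (1 + starRingEnd ℂ (φ 0) * (z * ψ z)) = φ 0 + z * ψ z) (n : ℕ) :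
    taylorCoeff φ (n + 1) + starRingEnd ℂ (φ 0) *
      ∑ i ∈ Finset.range (n + 1), taylorCoeff φ i * taylorCoeff ψ (n - i) = taylorCoeff ψ n := by
  have hφa := analyticAt_zero hφ
  have hψa := analyticAt_zero hψ
  have hza : AnalyticAt ℂ (fun z : ℂ => z) 0 := analyticAt_id
  have e := taylorSeries_congr_of_eqOn h
  rw [taylorSeries_mul hφa (by fun_prop), taylorSeries_add (by fun_prop) (by fun_prop),
    taylorSeries_mul (by fun_prop) (by fun_prop), taylorSeries_add (by fun_prop) (by fun_prop),
    taylorSeries_mul hza hψa, taylorSeries_id, taylorSeries_const, taylorSeries_const,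
    taylorSeries_const] at e
  have e2 := congrArg (PowerSeries.coeff (n + 1)) e
  have e3 : taylorSeries φ * (PowerSeries.C 1 + PowerSeries.C (starRingEnd ℂ (φ 0)) *
      (PowerSeries.X * taylorSeries ψ)) = taylorSeries φ + PowerSeries.C (starRingEnd ℂ (φ 0)) *
      (PowerSeries.X * (taylorSeries φ * taylorSeries ψ)) := by
    rw [map_one]; ring
  rw [e3, map_add, map_add, PowerSeries.coeff_C_mul, PowerSeries.coeff_succ_X_mul,
    PowerSeries.coeff_succ_X_mul, coeff_mul_eq_sum_range, PowerSeries.coeff_C] at e2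
  simpa using e2

/-- The first four coefficients of a function bounded by `1` in the unit disk, in terms of its
Schur parameters. -/
theorem exists_schur_parameters {φ : ℂ → ℂ} (hφ : DifferentiableOn ℂ φ unitDisk)
    (hb : ∀ z ∈ unitDisk, ‖φ z‖ ≤ 1) :
    ∃ c₁ c₂ c₃ c₄ : ℂ, ‖c₁‖ ≤ 1 ∧ ‖c₂‖ ≤ 1 ∧ ‖c₃‖ ≤ 1 ∧ ‖c₄‖ ≤ 1 ∧
      taylorCoeff φ 0 = c₁ ∧
      taylorCoeff φ 1 = (1 - (‖c₁‖ ^ 2 : ℝ)) * c₂ ∧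
      taylorCoeff φ 2 = (1 - (‖c₁‖ ^ 2 : ℝ)) *
        ((1 - (‖c₂‖ ^ 2 : ℝ)) * c₃ - starRingEnd ℂ c₁ * c₂ ^ 2) ∧
      taylorCoeff φ 3 = (1 - (‖c₁‖ ^ 2 : ℝ)) * ((1 - (‖c₂‖ ^ 2 : ℝ)) *
        ((1 - (‖c₃‖ ^ 2 : ℝ)) * c₄ - starRingEnd ℂ c₂ * c₃ ^ 2 - 2 * starRingEnd ℂ c₁ * c₂ * c₃) +
        starRingEnd ℂ c₁ ^ 2 * c₂ ^ 3) := by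
  obtain ⟨φ₁, hd₁, hb₁, e₁⟩ := exists_schur_step hφ hb
  obtain ⟨φ₂, hd₂, hb₂, e₂⟩ := exists_schur_step hd₁ hb₁
  obtain ⟨φ₃, hd₃, hb₃, e₃⟩ := exists_schur_step hd₂ hb₂
  have n₁ : (((‖φ 0‖ ^ 2 : ℝ)) : ℂ) = starRingEnd ℂ (φ 0) * φ 0 := by
    rw [← Complex.normSq_eq_norm_sq, Complex.normSq_eq_conj_mul_self]
  have n₂ : (((‖φ₁ 0‖ ^ 2 : ℝ)) : ℂ) = starRingEnd ℂ (φ₁ 0) * φ₁ 0 := by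
    rw [← Complex.normSq_eq_norm_sq, Complex.normSq_eq_conj_mul_self]
  have n₃ : (((‖φ₂ 0‖ ^ 2 : ℝ)) : ℂ) = starRingEnd ℂ (φ₂ 0) * φ₂ 0 := by
    rw [← Complex.normSq_eq_norm_sq, Complex.normSq_eq_conj_mul_self]
  refine ⟨φ 0, φ₁ 0, φ₂ 0, φ₃ 0, hb 0 zero_mem_unitDisk, hb₁ 0 zero_mem_unitDisk,
    hb₂ 0 zero_mem_unitDisk, hb₃ 0 zero_mem_unitDisk, taylorCoeff_zero φ, ?_⟩
  have s₁ := schur_step_coeffs hφ hd₁ e₁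
  have s₂ := schur_step_coeffs hd₁ hd₂ e₂
  have s₃ := schur_step_coeffs hd₂ hd₃ e₃
  have a0 := s₁ 0
  have a1 := s₁ 1
  have a2 := s₁ 2
  have b0 := s₂ 0
  have b1 := s₂ 1
  have d0 := s₃ 0
  simp only [Finset.sum_range_succ, Finset.sum_range_zero, taylorCoeff_zero, zero_add,
    Nat.reduceAdd, Nat.reduceSub, Nat.sub_zero, Nat.sub_self] at a0 a1 a2 b0 b1 d0
  rw [n₁, n₂, n₃]
  -- With the conjugates as independent variables, the rest is polynomial elimination.
  generalize starRingEnd ℂ (φ 0) = k₁ at *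
  generalize starRingEnd ℂ (φ₁ 0) = k₂ at *
  generalize starRingEnd ℂ (φ₂ 0) = k₃ at *
  have a0' : taylorCoeff φ 1 = (1 - k₁ * φ 0) * φ₁ 0 := by linear_combination a0
  have b0' : taylorCoeff φ₁ 1 = (1 - k₂ * φ₁ 0) * φ₂ 0 := by linear_combination b0
  have d0' : taylorCoeff φ₂ 1 = (1 - k₃ * φ₂ 0) * φ₃ 0 := by linear_combination d0
  rw [b0', d0'] at b1
  have b1' : taylorCoeff φ₁ 2 = (1 - k₂ * φ₁ 0) * ((1 - k₃ * φ₂ 0) * φ₃ 0 - k₂ * φ₂ 0 ^ 2) := by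
    linear_combination b1
  rw [a0', b0'] at a1
  have a1' : taylorCoeff φ 2 = (1 - k₁ * φ 0) * ((1 - k₂ * φ₁ 0) * φ₂ 0 - k₁ * φ₁ 0 ^ 2) := by
    linear_combination a1
  rw [a0', a1', b0', b1'] at a2
  exact ⟨a0', a1', by linear_combination a2⟩

/-! ### Real inequalities for the moduli of the Schur parameters -/

/-- Multiplying the bracket by 1 - x makes it a complete square in (1 - x) y, without division. What
remains is 1 - (119/144) x² + (37/144) x³ ≤ 1. -/
theorem cubic_majorant_le_one {x y : ℝ} (hx0 : 0 ≤ x) (hx1 : x ≤ 1) :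
    (1 - x ^ 2) * ((1 - y ^ 2) + x * y ^ 2 + 5 / 6 * x * y) + 1 / 12 * x ^ 3 ≤ 1 := by
  have h1 : (1 - x) * ((1 - y ^ 2) + x * y ^ 2 + 5 / 6 * x * y) ≤ 1 - x + 25 / 144 * x ^ 2 := by
    nlinarith [sq_nonneg ((1 - x) * y - 5 / 12 * x)]
  have h2 : x ^ 2 * (1 - x) ≥ 0 := mul_nonneg (sq_nonneg x) (by linarith)
  nlinarith [mul_le_mul_of_nonneg_left h1 (by linarith : 0 ≤ 1 + x), sq_nonneg x]

/-- Used with a, b depending on y and a', b' constants valid on a range of y: only a quadratic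
inequality in u = x² is left to check. -/
theorem quartic_quadratic_le_one {a b a' b' u : ℝ} (hu0 : 0 ≤ u) (hu1 : u ≤ 1)
    (ha : a ≤ a') (hb : b ≤ b')
    (h : (1 - u) * (a' + b' * u) + 503 / 4608 * u ^ 2 ≤ 1) :
    (1 - u) * (a + b * u) + 503 / 4608 * u ^ 2 ≤ 1 := by
  refine le_trans ?_ h
  gcongr

/-- Here A stands for |173/144 u - 7/18|, bounded by the chord of this convex function over [0, 1].
The bracket becomes a(y) + b(y) u with a decreasing and b increasing. -/
theorem quartic_majorant_small {u y A : ℝ} (hu0 : 0 ≤ u) (hu1 : u ≤ 1) (hy0 : 0 ≤ y)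
    (hy1 : y ≤ 1 / 2) (hA : A ≤ 7 / 18 + 61 / 144 * u) :
    (1 - u) * ((1 - y ^ 2 + (1 + y) * (2 * y + 13 / 16) ^ 2 * u / 4) + u * y ^ 3 + A * y ^ 2 +
      85 / 288 * u * y) + 503 / 4608 * u ^ 2 ≤ 1 := by
  have h1 : (1 - u) * ((1 - y ^ 2 + (1 + y) * (2 * y + 13 / 16) ^ 2 * u / 4) + u * y ^ 3 +
      A * y ^ 2 + 85 / 288 * u * y) ≤ (1 - u) * ((1 - 11 / 18 * y ^ 2) +
      ((1 + y) * (2 * y + 13 / 16) ^ 2 / 4 + y ^ 3 + 61 / 144 * y ^ 2 + 85 / 288 * y) * u) := by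
    refine mul_le_mul_of_nonneg_left ?_ (by linarith)
    nlinarith [mul_le_mul_of_nonneg_right hA (sq_nonneg y)]
  refine (add_le_add_left h1 _).trans ?_
  have hbmono : ∀ d : ℝ, y ≤ d → (1 + y) * (2 * y + 13 / 16) ^ 2 / 4 + y ^ 3 + 61 / 144 * y ^ 2 +
      85 / 288 * y ≤ (1 + d) * (2 * d + 13 / 16) ^ 2 / 4 + d ^ 3 + 61 / 144 * d ^ 2 +
      85 / 288 * d := by
    intro d hd
    have hd0 : 0 ≤ d := hy0.trans hd
    gcongr
  -- On each subinterval a' bounds a at the left end and b' bounds b at the right end. The squares u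
  -- - 1/10 and u - 6/25 are centred near the maximiser of the resulting quadratic.
  rcases le_total y (3 / 10) with h3 | h3
  · have hb := hbmono _ h3
    norm_num at hb
    refine quartic_quadratic_le_one (a' := 1) (b' := 0.81) hu0 hu1 (by nlinarith)
      (hb.trans (by norm_num)) ?_
    nlinarith
  rcases le_total y (2 / 5) with h4 | h4
  · have hb := hbmono _ h4
    norm_num at hb
    refine quartic_quadratic_le_one (a' := 0.945) (b' := 1.17) hu0 hu1 (by nlinarith)
      (hb.trans (by norm_num)) ?_
    nlinarith [sq_nonneg (u - 1 / 10)]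
  · have hb := hbmono _ hy1
    norm_num at hb
    refine quartic_quadratic_le_one (a' := 0.903) (b' := 1.62) hu0 hu1 (by nlinarith)
      (hb.trans (by norm_num)) ?_
    nlinarith [sq_nonneg (u - 6 / 25)]

theorem quartic_majorant_large {u y : ℝ} (hu0 : 0 ≤ u) (hu1 : u ≤ 1) (hy0 : 1 / 2 ≤ y)
    (hy1 : y ≤ 1) :
    (1 - u) * ((1 - y ^ 2) * (1 / 2 + y + (2 * y + 13 / 16) ^ 2 * u / 2) + u * y ^ 3 +
      |173 / 144 * u - 7 / 18| * y ^ 2 + 85 / 288 * u * y) + 503 / 4608 * u ^ 2 ≤ 1 := by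
  have hyn : 0 ≤ y := by linarith
  have hd0 : 0 ≤ y - 1 / 2 := by linarith
  -- Both signs are treated for every u in [0, 1], so the sign condition is dropped. The squares
  -- below are centred near the maximisers in y of the two coefficients, or in u of the final
  -- quadratic.
  rcases abs_cases (173 / 144 * u - 7 / 18) with ⟨h, -⟩ | ⟨h, -⟩ <;> rw [h]
  · have e : (1 - y ^ 2) * (1 / 2 + y + (2 * y + 13 / 16) ^ 2 * u / 2) + u * y ^ 3 +
        (173 / 144 * u - 7 / 18) * y ^ 2 + 85 / 288 * u * y =
        ((1 - y ^ 2) * (1 / 2 + y) - 7 / 18 * y ^ 2) + ((1 - y ^ 2) * (2 * y + 13 / 16) ^ 2 / 2 +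
          y ^ 3 + 173 / 144 * y ^ 2 + 85 / 288 * y) * u := by ring
    rw [e]
    rcases le_total y (3 / 5) with h5 | h5
    · refine quartic_quadratic_le_one (a' := 0.66) (b' := 2.2) hu0 hu1 ?_ ?_ ?_
      · nlinarith [mul_nonneg hd0 (sub_nonneg.2 hy1)]
      · nlinarith [mul_nonneg hd0 (sub_nonneg.2 h5),
          mul_nonneg hyn (mul_nonneg hd0 (sub_nonneg.2 h5)),
          mul_nonneg (sq_nonneg y) (mul_nonneg hd0 (sub_nonneg.2 h5))]
      · nlinarith [sq_nonneg (u - 7 / 19)]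
    · refine quartic_quadratic_le_one (a' := 0.566) (b' := 2.64) hu0 hu1 ?_ ?_ ?_
      · nlinarith [mul_nonneg (sub_nonneg.2 h5) (sq_nonneg y), mul_nonneg (sub_nonneg.2 h5) hyn]
      · nlinarith [mul_nonneg hyn (sq_nonneg (y - 22 / 25)), sq_nonneg (y - 22 / 25),
          sq_nonneg (y * (y - 22 / 25))]
      · nlinarith [sq_nonneg (u - 41 / 100)]
  · have e : (1 - y ^ 2) * (1 / 2 + y + (2 * y + 13 / 16) ^ 2 * u / 2) + u * y ^ 3 +
        -(173 / 144 * u - 7 / 18) * y ^ 2 + 85 / 288 * u * y =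
        ((1 - y ^ 2) * (1 / 2 + y) + 7 / 18 * y ^ 2) + ((1 - y ^ 2) * (2 * y + 13 / 16) ^ 2 / 2 +
          y ^ 3 - 173 / 144 * y ^ 2 + 85 / 288 * y) * u := by ring
    rw [e]
    refine quartic_quadratic_le_one (a' := 0.86) (b' := 1.3) hu0 hu1 ?_ ?_ ?_
    · nlinarith [mul_nonneg hyn (sq_nonneg (y - 27 / 50)), sq_nonneg (y - 27 / 50),
        sq_nonneg (y * (y - 27 / 50))]
    · nlinarith [mul_nonneg hyn (sq_nonneg (y - 61 / 100)), sq_nonneg (y - 61 / 100),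
        sq_nonneg (y * (y - 61 / 100))]
    · nlinarith [sq_nonneg (u - 1 / 6)]

/-- First eliminate t. For y ≤ 1/2 complete the square in (1 - y) t. For y near 1 that is too lossy,
so for y ≥ 1/2 use B x t ≤ t²/2 + B² x²/2, with B = 2y + 13/16, and then t² ≤ 1. -/
theorem quartic_majorant_le_one {x y t : ℝ} (hx0 : 0 ≤ x) (hx1 : x ≤ 1) (hy0 : 0 ≤ y)
    (hy1 : y ≤ 1) (ht0 : 0 ≤ t) (ht1 : t ≤ 1) :
    (1 - x ^ 2) * ((1 - y ^ 2) * ((1 - t ^ 2) + y * t ^ 2 + (2 * y + 13 / 16) * x * t) +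
      x ^ 2 * y ^ 3 + |173 / 144 * x ^ 2 - 7 / 18| * y ^ 2 + 85 / 288 * x ^ 2 * y) +
      503 / 4608 * x ^ 4 ≤ 1 := by
  have hu0 : 0 ≤ x ^ 2 := sq_nonneg x
  have hu1 : x ^ 2 ≤ 1 := by nlinarith
  have e : x ^ 4 = (x ^ 2) ^ 2 := by ring
  have hy2 : 0 ≤ 1 - y ^ 2 := by nlinarith
  rcases le_total y (1 / 2) with h | h
  · have h1 : (1 - y ^ 2) * ((1 - t ^ 2) + y * t ^ 2 + (2 * y + 13 / 16) * x * t) ≤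
        1 - y ^ 2 + (1 + y) * (2 * y + 13 / 16) ^ 2 * x ^ 2 / 4 := by
      nlinarith [mul_nonneg (by linarith : 0 ≤ 1 + y)
        (sq_nonneg ((1 - y) * t - (2 * y + 13 / 16) * x / 2))]
    have h2 : |173 / 144 * x ^ 2 - 7 / 18| ≤ 7 / 18 + 61 / 144 * x ^ 2 := by
      rw [abs_le]; constructor <;> nlinarith
    rw [e]
    refine le_trans ?_ (quartic_majorant_small hu0 hu1 hy0 h h2)
    gcongr
  · have h1 : (1 - t ^ 2) + y * t ^ 2 + (2 * y + 13 / 16) * x * t ≤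
        1 / 2 + y + (2 * y + 13 / 16) ^ 2 * x ^ 2 / 2 := by
      nlinarith [sq_nonneg (t - (2 * y + 13 / 16) * x),
        mul_nonneg (by linarith : 0 ≤ y - 1 / 2) (by nlinarith : 0 ≤ 1 - t ^ 2)]
    rw [e]
    refine le_trans ?_ (quartic_majorant_large hu0 hu1 h hy1)
    gcongr

/-! ### The coefficient functionals for γ₃ and γ₄ -/

theorem norm_cubic_schur_le_one {c₁ c₂ c₃ : ℂ} (h₁ : ‖c₁‖ ≤ 1) (h₂ : ‖c₂‖ ≤ 1) (h₃ : ‖c₃‖ ≤ 1)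
    {b₁ b₂ : ℂ} (e₁ : b₁ = (1 - (‖c₁‖ ^ 2 : ℝ)) * c₂)
    (e₂ : b₂ = (1 - (‖c₁‖ ^ 2 : ℝ)) * ((1 - (‖c₂‖ ^ 2 : ℝ)) * c₃ - starRingEnd ℂ c₁ * c₂ ^ 2)) :
    ‖b₂ - 5 / 6 * c₁ * b₁ - 1 / 12 * c₁ ^ 3‖ ≤ 1 := by
  have hx : 0 ≤ 1 - ‖c₁‖ ^ 2 := by nlinarith [norm_nonneg c₁]
  have hy : 0 ≤ 1 - ‖c₂‖ ^ 2 := by nlinarith [norm_nonneg c₂]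
  have e : b₂ - 5 / 6 * c₁ * b₁ - 1 / 12 * c₁ ^ 3 =
      ((1 - ‖c₁‖ ^ 2 : ℝ) : ℂ) * (((1 - ‖c₂‖ ^ 2 : ℝ) : ℂ) * c₃ + (-(starRingEnd ℂ c₁ * c₂ ^ 2)) +
        (-(5 / 6 * c₁ * c₂))) + (-(1 / 12 * c₁ ^ 3)) := by
    rw [e₁, e₂]; push_cast; ring
  rw [e]
  refine le_trans ?_ (cubic_majorant_le_one (y := ‖c₂‖) (norm_nonneg c₁) h₁)
  refine norm_add_le_of_le ?_ (by simp)
  rw [norm_mul, Complex.norm_real, Real.norm_of_nonneg hx]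
  refine mul_le_mul_of_nonneg_left (norm_add_le_of_le (norm_add_le_of_le ?_ (by simp))
    (by simp)) hx
  rw [norm_mul, Complex.norm_real, Real.norm_of_nonneg hy]
  exact mul_le_of_le_one_right hy h₃

theorem norm_quartic_schur_le_one {c₁ c₂ c₃ c₄ : ℂ} (h₁ : ‖c₁‖ ≤ 1) (h₂ : ‖c₂‖ ≤ 1)
    (h₃ : ‖c₃‖ ≤ 1) (h₄ : ‖c₄‖ ≤ 1) {b₁ b₂ b₃ : ℂ} (e₁ : b₁ = (1 - (‖c₁‖ ^ 2 : ℝ)) * c₂)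
    (e₂ : b₂ = (1 - (‖c₁‖ ^ 2 : ℝ)) * ((1 - (‖c₂‖ ^ 2 : ℝ)) * c₃ - starRingEnd ℂ c₁ * c₂ ^ 2))
    (e₃ : b₃ = (1 - (‖c₁‖ ^ 2 : ℝ)) * ((1 - (‖c₂‖ ^ 2 : ℝ)) *
      ((1 - (‖c₃‖ ^ 2 : ℝ)) * c₄ - starRingEnd ℂ c₂ * c₃ ^ 2 - 2 * starRingEnd ℂ c₁ * c₂ * c₃) +
        starRingEnd ℂ c₁ ^ 2 * c₂ ^ 3)) :
    ‖b₃ - 13 / 16 * c₁ * b₂ - 7 / 18 * b₁ ^ 2 - 85 / 288 * c₁ ^ 2 * b₁ + 503 / 4608 * c₁ ^ 4‖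
      ≤ 1 := by
  have hx : 0 ≤ 1 - ‖c₁‖ ^ 2 := by nlinarith [norm_nonneg c₁]
  have hy : 0 ≤ 1 - ‖c₂‖ ^ 2 := by nlinarith [norm_nonneg c₂]
  have ht : 0 ≤ 1 - ‖c₃‖ ^ 2 := by nlinarith [norm_nonneg c₃]
  have n₁ : (((‖c₁‖ ^ 2 : ℝ)) : ℂ) = starRingEnd ℂ c₁ * c₁ := by
    rw [← Complex.normSq_eq_norm_sq, Complex.normSq_eq_conj_mul_self]
  -- The two c₂² contributions have opposite signs and are merged before taking norms: 13/16 |c₁|² -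
  -- 7/18 (1 - |c₁|²) = 173/144 |c₁|² - 7/18.
  have e : b₃ - 13 / 16 * c₁ * b₂ - 7 / 18 * b₁ ^ 2 - 85 / 288 * c₁ ^ 2 * b₁ +
      503 / 4608 * c₁ ^ 4 =
      ((1 - ‖c₁‖ ^ 2 : ℝ) : ℂ) * (((1 - ‖c₂‖ ^ 2 : ℝ) : ℂ) *
        (((1 - ‖c₃‖ ^ 2 : ℝ) : ℂ) * c₄ + (-(starRingEnd ℂ c₂ * c₃ ^ 2)) +
          (-((2 * starRingEnd ℂ c₁ * c₂ + 13 / 16 * c₁) * c₃))) +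
        starRingEnd ℂ c₁ ^ 2 * c₂ ^ 3 + ((173 / 144 * ‖c₁‖ ^ 2 - 7 / 18 : ℝ) : ℂ) * c₂ ^ 2 +
        (-(85 / 288 * c₁ ^ 2 * c₂))) + 503 / 4608 * c₁ ^ 4 := by
    have n₁' : (‖c₁‖ : ℂ) ^ 2 = starRingEnd ℂ c₁ * c₁ := by rw [← n₁]; push_cast; rfl
    rw [e₁, e₂, e₃]
    push_cast
    rw [n₁']
    ring
  rw [e]
  refine le_trans ?_ (quartic_majorant_le_one (norm_nonneg c₁) h₁ (norm_nonneg c₂) h₂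
    (norm_nonneg c₃) h₃)
  refine norm_add_le_of_le ?_ (by simp)
  rw [norm_mul, Complex.norm_real, Real.norm_of_nonneg hx]
  refine mul_le_mul_of_nonneg_left (norm_add_le_of_le (norm_add_le_of_le
    (norm_add_le_of_le ?_ (by simp)) ?_) (by simp)) hx
  · rw [norm_mul, Complex.norm_real, Real.norm_of_nonneg hy]
    refine mul_le_mul_of_nonneg_left (norm_add_le_of_le (norm_add_le_of_le ?_ (by simp)) ?_) hy
    · rw [norm_mul, Complex.norm_real, Real.norm_of_nonneg ht]
      exact mul_le_of_le_one_right ht h₄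
    · rw [norm_neg, norm_mul]
      refine mul_le_mul_of_nonneg_right ?_ (norm_nonneg _)
      refine (norm_add_le _ _).trans (le_of_eq ?_)
      simp
      ring
  · rw [norm_mul, Complex.norm_real, Real.norm_eq_abs, norm_pow]

/-! ### Logarithmic coefficients in terms of the Schwarz function -/

theorem mul_dslope_zero {f : ℂ → ℂ} (hf : f 0 = 0) (z : ℂ) : z * dslope f 0 z = f z := by
  simpa [hf] using sub_smul_dslope f 0 z

theorem differentiableOn_dslope_zero {f : ℂ → ℂ} (hf : DifferentiableOn ℂ f unitDisk) :
    DifferentiableOn ℂ (dslope f 0) unitDisk :=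
  (Complex.differentiableOn_dslope unitDisk_mem_nhds).2 hf

theorem taylorCoeff_dslope_zero {f : ℂ → ℂ} (hf : DifferentiableOn ℂ f unitDisk) (h0 : f 0 = 0)
    (n : ℕ) : taylorCoeff (dslope f 0) n = taylorCoeff f (n + 1) := by
  have hza : AnalyticAt ℂ (fun z : ℂ => z) 0 := analyticAt_id
  have e : taylorSeries f = PowerSeries.X * taylorSeries (dslope f 0) := by
    rw [← taylorSeries_id, ← taylorSeries_mul hza
      (analyticAt_zero (differentiableOn_dslope_zero hf))]
    exact congrArg taylorSeries (funext fun z => (mul_dslope_zero h0 z).symm)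
  have e2 := congrArg (PowerSeries.coeff (n + 1)) e
  rw [PowerSeries.coeff_succ_X_mul] at e2
  simpa using e2.symm

theorem differentiableAt_of_mem {f : ℂ → ℂ} (hf : DifferentiableOn ℂ f unitDisk) {z : ℂ}
    (hz : z ∈ unitDisk) : DifferentiableAt ℂ f z :=
  hf.differentiableAt (isOpen_unitDisk.mem_nhds hz)

theorem differentiableOn_bean_comp {ω : ℂ → ℂ} (hω : DifferentiableOn ℂ ω unitDisk)
    (hb : ∀ z ∈ unitDisk, ‖ω z‖ < 1) : DifferentiableOn ℂ (fun z => bean (ω z)) unitDisk :=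
  differentiableOn_bean.comp hω fun z hz => mem_unitDisk.2 (hb z hz)

/-- The first Taylor coefficients of `√(1 + tanh ω)`. -/
theorem taylorCoeff_bean_comp {ω : ℂ → ℂ} (hω : DifferentiableOn ℂ ω unitDisk) (h0 : ω 0 = 0)
    (hb : ∀ z ∈ unitDisk, ‖ω z‖ < 1) {w : ℕ → ℂ} (hw : taylorCoeff ω = w) {p : ℂ → ℂ}
    (hp : ∀ z ∈ unitDisk, p z = bean (ω z)) :
    taylorCoeff p 0 = 1 ∧
    taylorCoeff p 1 = w 1 / 2 ∧
    taylorCoeff p 2 = w 2 / 2 - w 1 ^ 2 / 8 ∧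
    taylorCoeff p 3 = w 3 / 2 - w 1 * w 2 / 4 - 5 / 48 * w 1 ^ 3 ∧
    taylorCoeff p 4 = w 4 / 2 - (2 * w 1 * w 3 + w 2 ^ 2) / 8 - 5 / 16 * w 1 ^ 2 * w 2 +
      17 / 384 * w 1 ^ 4 := by
  subst hw
  have hpd : DifferentiableOn ℂ p unitDisk := (differentiableOn_bean_comp hω hb).congr hp
  have hpa := analyticAt_zero hpd
  have hωa := analyticAt_zero hω
  -- This equation determines the coefficients of p recursively from those of ω and p(0) = 1.
  have hode : Set.EqOn (fun z => 2 * deriv p z) (fun z => deriv ω z * (p z * (2 - p z * p z)))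
      unitDisk := by
    intro z hz
    have h1 : HasDerivAt (fun z => bean (ω z))
        (bean (ω z) * (2 - bean (ω z) ^ 2) / 2 * deriv ω z) z :=
      (hasDerivAt_bean (mem_unitDisk.2 (hb z hz))).comp z (differentiableAt_of_mem hω hz).hasDerivAt
    have h2 : p =ᶠ[𝓝 z] fun z => bean (ω z) :=
      Filter.eventually_of_mem (isOpen_unitDisk.mem_nhds hz) hp
    simp only [h2.deriv_eq, h1.deriv, hp z hz]
    ring
  have e := taylorSeries_congr_of_eqOn hode
  have hpa' := hpa.deriv
  have hωa' := hωa.deriv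
  rw [taylorSeries_mul (by fun_prop) (by fun_prop), taylorSeries_mul (by fun_prop) (by fun_prop),
    taylorSeries_mul (by fun_prop) (by fun_prop), taylorSeries_sub (by fun_prop) (by fun_prop),
    taylorSeries_mul (by fun_prop) (by fun_prop), taylorSeries_const] at e
  have e0 := congrArg (PowerSeries.coeff 0) e
  have e1 := congrArg (PowerSeries.coeff 1) e
  have e2 := congrArg (PowerSeries.coeff 2) e
  have e3 := congrArg (PowerSeries.coeff 3) e
  have p0 : taylorCoeff p 0 = 1 := by
    rw [taylorCoeff_zero, hp 0 zero_mem_unitDisk, h0, bean_zero]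
  clear hode hpd hpa hωa hpa' hωa' e hp
  simp only [PowerSeries.coeff_C_mul, coeff_mul_eq_sum_range, map_sub, PowerSeries.coeff_C,
    coeff_taylorSeries, taylorCoeff_deriv, Finset.sum_range_succ, Finset.sum_range_zero, zero_add,
    Nat.reduceAdd, Nat.reduceSub, Nat.sub_zero, Nat.sub_self, p0, if_true, one_ne_zero, if_false,
    OfNat.ofNat_ne_zero, zero_sub, Nat.cast_zero, Nat.cast_one, Nat.cast_ofNat, one_mul, mul_one]
    at e0 e1 e2 e3
  generalize taylorCoeff p = P at *
  generalize taylorCoeff ω = w at *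
  have p1 : P 1 = w 1 / 2 := by linear_combination e0 / 2
  rw [p1] at e1 e2 e3
  have p2 : P 2 = w 2 / 2 - w 1 ^ 2 / 8 := by linear_combination e1 / 4
  rw [p2] at e2 e3
  have p3 : P 3 = w 3 / 2 - w 1 * w 2 / 4 - 5 / 48 * w 1 ^ 3 := by linear_combination e2 / 6
  rw [p3] at e3
  exact ⟨p0, p1, p2, p3, by linear_combination e3 / 8⟩

/-- The first logarithmic coefficients in terms of the Taylor coefficients. -/
theorem IsLogCoeffs.eq_taylorCoeff {f : ℂ → ℂ} {γ : ℕ → ℂ} (hf : DifferentiableOn ℂ f unitDisk)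
    (h0 : f 0 = 0) (h1 : deriv f 0 = 1) (hγ : IsLogCoeffs f γ) {a : ℕ → ℂ}
    (ha : a = taylorCoeff f) :
    γ 1 = 1 / 2 * a 2 ∧
    γ 2 = 1 / 2 * (a 3 - 1 / 2 * a 2 ^ 2) ∧
    γ 3 = 1 / 2 * (a 4 - a 2 * a 3 + 1 / 3 * a 2 ^ 3) ∧
    γ 4 = 1 / 2 * (a 5 - a 2 * a 4 + a 2 ^ 2 * a 3 - 1 / 2 * a 3 ^ 2 - 1 / 4 * a 2 ^ 4) := by
  obtain ⟨F, hF, hF0, hexp, hsum⟩ := hγ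
  have hG := differentiableOn_dslope_zero hf
  have hGexp : ∀ z ∈ unitDisk, dslope f 0 z = Complex.exp (F z) := by
    intro z hz
    rcases eq_or_ne z 0 with rfl | hne
    · simp [hF0, h1]
    · rw [hexp z hz hne, ← mul_dslope_zero h0 z, mul_div_cancel_left₀ _ hne]
  have hode : Set.EqOn (deriv (dslope f 0)) (fun z => deriv F z * dslope f 0 z) unitDisk := by
    intro z hz
    have h2 : dslope f 0 =ᶠ[𝓝 z] fun z => Complex.exp (F z) :=
      Filter.eventually_of_mem (isOpen_unitDisk.mem_nhds hz) hGexp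
    simp only [h2.deriv_eq, (differentiableAt_of_mem hF hz).hasDerivAt.cexp.deriv, hGexp z hz]
    ring
  -- The series of F starts at z¹, so its constant coefficient is 0 rather than 2 γ₀.
  have hFc : taylorCoeff F = fun n => if n = 0 then 0 else 2 * γ n := by
    refine taylorCoeff_eq_of_hasSum fun z hz => ?_
    rw [← hasSum_nat_add_iff' 1]
    simpa [mul_assoc] using hsum z hz
  have e := taylorSeries_congr_of_eqOn hode
  rw [taylorSeries_mul (analyticAt_zero hF).deriv (analyticAt_zero hG)] at e
  have e0 := congrArg (PowerSeries.coeff 0) e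
  have e1 := congrArg (PowerSeries.coeff 1) e
  have e2 := congrArg (PowerSeries.coeff 2) e
  have e3 := congrArg (PowerSeries.coeff 3) e
  have a1 : a 1 = 1 := by simp [ha, taylorCoeff, h1]
  simp only [coeff_mul_eq_sum_range, coeff_taylorSeries, taylorCoeff_deriv, Finset.sum_range_succ,
    Finset.sum_range_zero, zero_add, Nat.reduceAdd, Nat.reduceSub, Nat.sub_zero, Nat.sub_self,
    taylorCoeff_dslope_zero hf h0, hFc, a1, one_ne_zero, if_false, OfNat.ofNat_ne_zero,
    Nat.cast_zero, Nat.cast_one, Nat.cast_ofNat, one_mul, mul_one, ← ha] at e0 e1 e2 e3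
  have g1 : γ 1 = 1 / 2 * a 2 := by linear_combination -e0 / 2
  rw [g1] at e1 e2 e3
  have g2 : γ 2 = 1 / 2 * (a 3 - 1 / 2 * a 2 ^ 2) := by linear_combination -e1 / 4
  rw [g2] at e2 e3
  have g3 : γ 3 = 1 / 2 * (a 4 - a 2 * a 3 + 1 / 3 * a 2 ^ 3) := by linear_combination -e2 / 6
  rw [g3] at e3
  exact ⟨g1, g2, g3, by linear_combination -e3 / 8⟩

/-- The first logarithmic coefficients of a function whose derivative is `√(1 + tanh ω)`. -/
theorem IsLogCoeffs.eq_of_deriv_eq_bean_comp {f ω : ℂ → ℂ} {γ : ℕ → ℂ}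
    (hf : DifferentiableOn ℂ f unitDisk) (h0 : f 0 = 0) (hγ : IsLogCoeffs f γ)
    (hω : DifferentiableOn ℂ ω unitDisk) (hω0 : ω 0 = 0) (hb : ∀ z ∈ unitDisk, ‖ω z‖ < 1)
    (hd : ∀ z ∈ unitDisk, deriv f z = bean (ω z)) {w : ℕ → ℂ} (hw : taylorCoeff ω = w) :
    γ 1 = 1 / 8 * w 1 ∧
    γ 2 = 1 / 12 * (w 2 - 7 / 16 * w 1 ^ 2) ∧
    γ 3 = 1 / 16 * (w 3 - 5 / 6 * w 1 * w 2 - 1 / 12 * w 1 ^ 3) ∧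
    γ 4 = 1 / 20 * (w 4 - 13 / 16 * w 1 * w 3 - 7 / 18 * w 2 ^ 2 - 85 / 288 * w 1 ^ 2 * w 2 +
      503 / 4608 * w 1 ^ 4) := by
  have h1 : deriv f 0 = 1 := by rw [hd 0 zero_mem_unitDisk, hω0, bean_zero]
  obtain ⟨-, p1, p2, p3, p4⟩ := taylorCoeff_bean_comp hω hω0 hb hw hd
  obtain ⟨g1, g2, g3, g4⟩ := hγ.eq_taylorCoeff hf h0 h1 rfl
  simp only [taylorCoeff_deriv, Nat.reduceAdd, Nat.cast_one, Nat.cast_ofNat] at p1 p2 p3 p4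
  generalize taylorCoeff f = a at *
  have a2 : a 2 = w 1 / 4 := by linear_combination p1 / 2
  have a3 : a 3 = (w 2 / 2 - w 1 ^ 2 / 8) / 3 := by linear_combination p2 / 3
  have a4 : a 4 = (w 3 / 2 - w 1 * w 2 / 4 - 5 / 48 * w 1 ^ 3) / 4 := by linear_combination p3 / 4
  have a5 : a 5 = (w 4 / 2 - (2 * w 1 * w 3 + w 2 ^ 2) / 8 - 5 / 16 * w 1 ^ 2 * w 2 +
      17 / 384 * w 1 ^ 4) / 5 := by linear_combination p4 / 5
  rw [a2] at g1
  rw [a2, a3] at g2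
  rw [a2, a3, a4] at g3
  rw [a2, a3, a4, a5] at g4
  exact ⟨by rw [g1]; ring, by rw [g2]; ring, by rw [g3]; ring, by rw [g4]; ring⟩

/-! ### Existence and bounds of the logarithmic coefficients -/

/-- Injectivity keeps G = f(z)/z away from 0, so G'/G has a primitive F on the disk with F(0) = 0; G
exp(-F) has zero derivative and equals 1. -/
theorem exists_isLogCoeffs {f : ℂ → ℂ} (hf : f ∈ ClassS) : ∃ γ : ℕ → ℂ, IsLogCoeffs f γ := by
  obtain ⟨hd, h0, h1, hinj⟩ := hf
  have hG := differentiableOn_dslope_zero hd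
  have hG0 : dslope f 0 0 = 1 := by simp [h1]
  have hne : ∀ z ∈ unitDisk, dslope f 0 z ≠ 0 := by
    intro z hz h
    have hfz : f z = f 0 := by rw [← mul_dslope_zero h0 z, h, mul_zero, h0]
    rw [hinj hz zero_mem_unitDisk hfz, hG0] at h
    exact one_ne_zero h
  have hL : DifferentiableOn ℂ (fun z => deriv (dslope f 0) z / dslope f 0 z) unitDisk :=
    (hG.deriv isOpen_unitDisk).fun_div hG hne
  obtain ⟨F, hF0, hF⟩ := (DifferentiableOn.isExactOn_ball hL).with_val_at 0 0
  have hFd : DifferentiableOn ℂ F unitDisk :=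
    fun z hz => (hF z hz).differentiableAt.differentiableWithinAt
  have hconst : ∀ z ∈ unitDisk, Complex.exp (F z) = dslope f 0 z := by
    intro z hz
    have hder : ∀ w ∈ unitDisk, HasDerivWithinAt (fun w => Complex.exp (-F w) * dslope f 0 w) 0
        unitDisk w := by
      intro w hw
      refine (((hF w hw).fun_neg.cexp.mul
        (differentiableAt_of_mem hG hw).hasDerivAt).congr_deriv ?_).hasDerivWithinAt
      have := hne w hw
      field_simp
      ring
    have h2 := (convex_ball (0 : ℂ) 1).norm_image_sub_le_of_norm_hasDerivWithin_le (C := 0) hder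
      (by simp) zero_mem_unitDisk hz
    simp only [zero_mul, norm_le_zero_iff, hF0, hG0, neg_zero, Complex.exp_zero, mul_one,
      sub_eq_zero, Complex.exp_neg] at h2
    exact ((inv_mul_eq_one₀ (Complex.exp_ne_zero _)).1 h2)
  refine ⟨fun n => taylorCoeff F n / 2, F, hFd, hF0, fun z hz hz0 => ?_, fun z hz => ?_⟩
  · rw [hconst z hz, ← mul_dslope_zero h0 z, mul_div_cancel_left₀ _ hz0]
  · have h3 := hasSum_taylorCoeff hFd hz
    rw [← hasSum_nat_add_iff' 1] at h3
    have e : ∀ k, 2 * (taylorCoeff F (k + 1) / 2 * z ^ (k + 1)) =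
        taylorCoeff F (k + 1) * z ^ (k + 1) := fun k => by ring
    simpa [e, taylorCoeff_zero, hF0] using h3

theorem norm_logCoeff_le {f : ℂ → ℂ} (hf : f ∈ ClassBT) {γ : ℕ → ℂ} (hγ : IsLogCoeffs f γ) :
    ∀ n ∈ Finset.Icc 1 4, ‖γ n‖ ≤ 1 / (4 * ((n : ℝ) + 1)) := by
  obtain ⟨⟨hd, h0, -, -⟩, ω, hω, hω0, hb, he⟩ := hf
  obtain ⟨g1, g2, g3, g4⟩ := hγ.eq_of_deriv_eq_bean_comp hd h0 hω hω0 hb he rfl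
  have hφb : ∀ z ∈ unitDisk, ‖dslope ω 0 z‖ ≤ 1 := fun z hz => by
    simpa using Complex.norm_dslope_le_div_of_mapsTo_ball (R₂ := 1) hω
      (fun w hw => by simpa [hω0] using (hb w hw).le) hz
  obtain ⟨c₁, c₂, c₃, c₄, h₁, h₂, h₃, h₄, e₁, e₂, e₃, e₄⟩ :=
    exists_schur_parameters (differentiableOn_dslope_zero hω) hφb
  rw [taylorCoeff_dslope_zero hω hω0] at e₁ e₂ e₃ e₄
  simp only [zero_add, Nat.reduceAdd] at e₁ e₂ e₃ e₄
  have hx : 0 ≤ 1 - ‖c₁‖ ^ 2 := by nlinarith [norm_nonneg c₁]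
  -- |w₂| ≤ 1 - |w₁|², and 7/16 < 1 absorbs the quadratic term.
  have k2 : ‖taylorCoeff ω 2 - 7 / 16 * c₁ ^ 2‖ ≤ 1 := by
    have : ‖taylorCoeff ω 2‖ ≤ 1 - ‖c₁‖ ^ 2 := by
      rw [e₂, norm_mul, ← Complex.ofReal_one, ← Complex.ofReal_sub, Complex.norm_real,
        Real.norm_of_nonneg hx]
      exact mul_le_of_le_one_right hx h₂
    refine (norm_sub_le_of_le this (le_refl _)).trans ?_
    simp only [norm_mul, norm_pow, norm_div, RCLike.norm_ofNat]
    nlinarith [norm_nonneg c₁]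
  have k3 := norm_cubic_schur_le_one h₁ h₂ h₃ e₂ e₃
  have k4 := norm_quartic_schur_le_one h₁ h₂ h₃ h₄ e₂ e₃ e₄
  rw [e₁] at g1 g2 g3 g4
  intro n hn
  obtain ⟨hn1, hn4⟩ := Finset.mem_Icc.1 hn
  interval_cases n
  · rw [g1, norm_mul]; norm_num; linarith
  · rw [g2, norm_mul]; norm_num; linarith
  · rw [g3, norm_mul]; norm_num; linarith
  · rw [g4, norm_mul]; norm_num; linarith

/-! ### The extremal functions -/

/-- The Noshiro–Warschawski criterion on the unit disk. -/
theorem injOn_of_re_deriv_pos {f f' : ℂ → ℂ} (hf : ∀ z ∈ unitDisk, HasDerivAt f (f' z) z)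
    (hpos : ∀ z ∈ unitDisk, 0 < (f' z).re) : Set.InjOn f unitDisk := by
  intro z hz w hw hzw
  by_contra hne
  have hmem : ∀ s ∈ Set.Icc (0 : ℝ) 1, z + (s : ℂ) * (w - z) ∈ unitDisk := by
    intro s hs
    have := (convex_ball (0 : ℂ) 1).add_smul_sub_mem hz hw hs
    rwa [Complex.real_smul] at this
  -- Rolle's theorem is applied to Re(f · conj(w - z)) along the segment, whose derivative is |w -
  -- z|² Re f' > 0.
  have hder : ∀ s ∈ Set.Icc (0 : ℝ) 1,
      HasDerivAt (fun s : ℝ => (f (z + (s : ℂ) * (w - z)) * starRingEnd ℂ (w - z)).re)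
        ((f' (z + (s : ℂ) * (w - z)) * (w - z) * starRingEnd ℂ (w - z)).re) s := by
    intro s hs
    have h1 : HasDerivAt (fun s : ℂ => z + s * (w - z)) (w - z) (s : ℂ) := by
      simpa using ((hasDerivAt_id (s : ℂ)).mul_const (w - z)).const_add z
    have h2 := (HasDerivAt.comp (s : ℂ) (hf _ (hmem s hs)) h1).mul_const (starRingEnd ℂ (w - z))
    exact h2.real_of_complex
  obtain ⟨s, hs, h0⟩ := exists_hasDerivAt_eq_zero zero_lt_one
    (fun s hs => (hder s hs).continuousAt.continuousWithinAt) (by simp [hzw])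
    fun s hs => hder s (Set.Ioo_subset_Icc_self hs)
  have h3 : 0 < Complex.normSq (w - z) := Complex.normSq_pos.2 (sub_ne_zero.2 (Ne.symm hne))
  rw [mul_assoc, Complex.mul_conj, Complex.re_mul_ofReal] at h0
  exact (mul_pos (hpos _ (hmem s (Set.Ioo_subset_Icc_self hs))) h3).ne' h0

theorem pow_mem_unitDisk {n : ℕ} (hn : n ≠ 0) {z : ℂ} (hz : z ∈ unitDisk) : z ^ n ∈ unitDisk := by
  rw [mem_unitDisk, norm_pow]
  exact pow_lt_one₀ (norm_nonneg z) (mem_unitDisk.1 hz) hn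

/-- The integrand has a primitive on the disk vanishing at 0; the fundamental theorem of calculus
along the segment identifies it with the integral. -/
theorem hasDerivAt_extremal {n : ℕ} (hn : n ≠ 0) {z : ℂ} (hz : z ∈ unitDisk) :
    HasDerivAt (extremal n) (bean (z ^ n)) z := by
  have hd : DifferentiableOn ℂ (fun z => bean (z ^ n)) unitDisk :=
    differentiableOn_bean.comp (by fun_prop) fun z hz => pow_mem_unitDisk hn hz
  obtain ⟨G, hG0, hG⟩ := (DifferentiableOn.isExactOn_ball hd).with_val_at 0 0
  have heq : ∀ w ∈ unitDisk, extremal n w = G w := by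
    intro w hw
    have hmem : ∀ s ∈ Set.uIcc (0 : ℝ) 1, (s : ℂ) * w ∈ unitDisk := by
      intro s hs
      rw [Set.uIcc_of_le zero_le_one] at hs
      have := (convex_ball (0 : ℂ) 1).add_smul_sub_mem zero_mem_unitDisk hw hs
      rwa [Complex.real_smul, sub_zero, zero_add] at this
    have hder : ∀ s ∈ Set.uIcc (0 : ℝ) 1,
        HasDerivAt (fun s : ℝ => G ((s : ℂ) * w)) (bean (((s : ℂ) * w) ^ n) * w) s := by
      intro s hs
      have h1 : HasDerivAt (fun s : ℂ => s * w) w (s : ℂ) := by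
        simpa using (hasDerivAt_id (s : ℂ)).mul_const w
      exact (HasDerivAt.comp (s : ℂ) (hG _ (hmem s hs)) h1).comp_ofReal
    have hcont : ContinuousOn (fun s : ℝ => bean (((s : ℂ) * w) ^ n) * w) (Set.uIcc 0 1) := by
      refine ContinuousOn.mul ?_ continuousOn_const
      exact hd.continuousOn.comp (by fun_prop) hmem
    rw [extremal, intervalIntegral.integral_eq_sub_of_hasDerivAt hder hcont.intervalIntegrable]
    simp [hG0]
  refine (hG z hz).congr_of_eventuallyEq ?_
  exact Filter.eventually_of_mem (isOpen_unitDisk.mem_nhds hz) heq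

theorem extremal_zero (n : ℕ) : extremal n 0 = 0 := by simp [extremal]

theorem extremal_mem_classBT {n : ℕ} (hn : n ≠ 0) : extremal n ∈ ClassBT := by
  refine ⟨⟨fun z hz => (hasDerivAt_extremal hn hz).differentiableAt.differentiableWithinAt,
    extremal_zero n, ?_, injOn_of_re_deriv_pos (fun z hz => hasDerivAt_extremal hn hz)
      fun z hz => bean_re_pos (pow_mem_unitDisk hn hz)⟩,
    fun z => z ^ n, by fun_prop, zero_pow hn, fun z hz => mem_unitDisk.1 (pow_mem_unitDisk hn hz),
    fun z hz => (hasDerivAt_extremal hn hz).deriv⟩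
  rw [(hasDerivAt_extremal hn zero_mem_unitDisk).deriv, zero_pow hn, bean_zero]

/-- For ω = zⁿ only wₙ = 1 is nonzero, and every other monomial in the formula for γₙ contains some
wₖ with k < n. -/
theorem norm_logCoeff_extremal {n : ℕ} (hn : n ∈ Finset.Icc 1 4) {γ : ℕ → ℂ}
    (hγ : IsLogCoeffs (extremal n) γ) : ‖γ n‖ = 1 / (4 * ((n : ℝ) + 1)) := by
  obtain ⟨hn1, hn4⟩ := Finset.mem_Icc.1 hn
  have hn0 : n ≠ 0 := by omega
  have hw : taylorCoeff (fun z => z ^ n) = fun k => if k = n then 1 else 0 := by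
    ext k
    rw [← coeff_taylorSeries, taylorSeries_pow_id, PowerSeries.coeff_X_pow]
  obtain ⟨g1, g2, g3, g4⟩ := hγ.eq_of_deriv_eq_bean_comp
    (fun z hz => (hasDerivAt_extremal hn0 hz).differentiableAt.differentiableWithinAt)
    (extremal_zero n) (differentiable_pow n).differentiableOn (zero_pow hn0)
    (fun z hz => mem_unitDisk.1 (pow_mem_unitDisk hn0 hz))
    (fun z hz => (hasDerivAt_extremal hn0 hz).deriv) hw
  interval_cases n
  · rw [g1]; norm_num
  · rw [g2]; norm_num
  · rw [g3]; norm_num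
  · rw [g4]; norm_num

/-! ### Expansions at the origin -/

/-- Mean value inequality on the closed disk of radius |z|, where the derivative is at most C |z|ᵐ.
-/
theorem isBigO_pow_succ_of_hasDerivAt {h h' : ℂ → ℂ} {m : ℕ} (h0 : h 0 = 0)
    (hd : ∀ z ∈ unitDisk, HasDerivAt h (h' z) z) (hO : h' =O[𝓝 0] fun z => z ^ m) :
    h =O[𝓝 0] fun z => z ^ (m + 1) := by
  obtain ⟨C, hC0, hC⟩ := hO.exists_nonneg
  rw [Asymptotics.isBigOWith_iff, Metric.eventually_nhds_iff] at hC
  obtain ⟨ε, hε, hball⟩ := hC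
  refine Asymptotics.IsBigO.of_bound C ?_
  filter_upwards [Metric.ball_mem_nhds (0 : ℂ) (lt_min hε one_pos)] with z hz
  rw [mem_ball_zero_iff, lt_min_iff] at hz
  have hsub : ∀ w ∈ Metric.closedBall (0 : ℂ) ‖z‖, ‖w‖ ≤ ‖z‖ := fun w hw => by simpa using hw
  have key := (convex_closedBall (0 : ℂ) ‖z‖).norm_image_sub_le_of_norm_hasDerivWithin_le
    (C := C * ‖z‖ ^ m)
    (fun w hw => (hd w (mem_unitDisk.2 ((hsub w hw).trans_lt hz.2))).hasDerivWithinAt)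
    (fun w hw => ?_) (Metric.mem_closedBall_self (norm_nonneg z))
    (show z ∈ Metric.closedBall (0 : ℂ) ‖z‖ by simp)
  · simpa [h0, pow_succ, mul_assoc] using key
  · refine (hball (by simpa using (hsub w hw).trans_lt hz.1)).trans ?_
    rw [norm_pow]
    gcongr
    exact hsub w hw

/-- Expansion of the extremal functions from that of `√(1 + tanh z)`. -/
theorem isBigO_extremal_sub {n m : ℕ} (hn : n ≠ 0) {q Q : ℂ → ℂ}
    (hq : (fun z => bean z - q z) =O[𝓝 0] fun z => z ^ m) (hQ0 : Q 0 = 0)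
    (hQ : ∀ z, HasDerivAt Q (q (z ^ n)) z) :
    (fun z => extremal n z - Q z) =O[𝓝 0] fun z => z ^ (n * m + 1) := by
  refine isBigO_pow_succ_of_hasDerivAt (by simp [extremal_zero, hQ0])
    (fun z hz => (hasDerivAt_extremal hn hz).fun_sub (hQ z)) ?_
  have ht : Filter.Tendsto (fun z : ℂ => z ^ n) (𝓝 0) (𝓝 0) := by
    simpa [hn] using (continuous_pow n (M := ℂ)).tendsto 0
  simpa [Function.comp_def, ← pow_mul] using hq.comp_tendsto ht

theorem taylorCoeff_bean :
    taylorCoeff bean 0 = 1 ∧ taylorCoeff bean 1 = 1 / 2 ∧ taylorCoeff bean 2 = -1 / 8 ∧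
      taylorCoeff bean 3 = -5 / 48 ∧ taylorCoeff bean 4 = 17 / 384 := by
  have hw : taylorCoeff (fun z => z) = fun k => if k = 1 then 1 else 0 := by
    ext k
    rw [← coeff_taylorSeries, taylorSeries_id, PowerSeries.coeff_X]
  have := taylorCoeff_bean_comp (p := bean) (ω := fun z => z) (by fun_prop) rfl
    (fun z hz => mem_unitDisk.1 hz) hw fun z _ => rfl
  norm_num at this ⊢
  exact this

theorem isBigO_bean_sub (m : ℕ) :
    (fun z => bean z - ∑ k ∈ Finset.range m, taylorCoeff bean k * z ^ k) =O[𝓝 0]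
      fun z => z ^ m := by
  have hba := analyticAt_zero differentiableOn_bean
  have hS : ∀ m, taylorSeries (fun z => ∑ k ∈ Finset.range m, taylorCoeff bean k * z ^ k) =
      ∑ k ∈ Finset.range m, PowerSeries.C (taylorCoeff bean k) * PowerSeries.X ^ k := by
    intro m
    induction m with
    | zero => simpa using taylorSeries_const 0
    | succ m ih =>
      simp_rw [Finset.sum_range_succ]
      rw [taylorSeries_add (by fun_prop) (by fun_prop), ih,
        taylorSeries_mul (by fun_prop) (by fun_prop), taylorSeries_const, taylorSeries_pow_id]
  refine isBigO_pow_of_taylorCoeff_eq_zero (by fun_prop) fun j hj => ?_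
  rw [← coeff_taylorSeries, taylorSeries_sub hba (by fun_prop), hS, map_sub, map_sum]
  simp [PowerSeries.coeff_X_pow, hj]

end BoundedTurning


theorem mainTheorem1 :
    (∀ f ∈ BoundedTurning.ClassBT,
      (∃ γ : ℕ → ℂ, BoundedTurning.IsLogCoeffs f γ) ∧
      ∀ a γ : ℕ → ℂ, a = BoundedTurning.taylorCoeff f → BoundedTurning.IsLogCoeffs f γ →
        (γ 1 = 1 / 2 * a 2 ∧
          γ 2 = 1 / 2 * (a 3 - 1 / 2 * a 2 ^ 2) ∧
          γ 3 = 1 / 2 * (a 4 - a 2 * a 3 + 1 / 3 * a 2 ^ 3) ∧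
          γ 4 = 1 / 2 * (a 5 - a 2 * a 4 + a 2 ^ 2 * a 3 - 1 / 2 * a 3 ^ 2 - 1 / 4 * a 2 ^ 4)) ∧
        ∀ n ∈ Finset.Icc 1 4, ‖γ n‖ ≤ 1 / (4 * ((n : ℝ) + 1))) ∧
    (∀ n ∈ Finset.Icc 1 4,
      BoundedTurning.extremal n ∈ BoundedTurning.ClassBT ∧
      ∀ γ : ℕ → ℂ, BoundedTurning.IsLogCoeffs (BoundedTurning.extremal n) γ →
        ‖γ n‖ = 1 / (4 * ((n : ℝ) + 1))) ∧
    ((fun z => BoundedTurning.extremal 1 z -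
        (z + z ^ 2 / 4 - z ^ 3 / 24 - 5 * z ^ 4 / 192 + 17 * z ^ 5 / 1920))
        =O[𝓝 (0 : ℂ)] (fun z => z ^ 6) ∧
      (fun z => BoundedTurning.extremal 2 z - (z + z ^ 3 / 6 - z ^ 5 / 40 - 5 * z ^ 7 / 336))
        =O[𝓝 (0 : ℂ)] (fun z => z ^ 9) ∧
      (fun z => BoundedTurning.extremal 3 z - (z + z ^ 4 / 8 - z ^ 7 / 56))
        =O[𝓝 (0 : ℂ)] (fun z => z ^ 10) ∧
      (fun z => BoundedTurning.extremal 4 z - (z + z ^ 5 / 10 - z ^ 9 / 72))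
        =O[𝓝 (0 : ℂ)] (fun z => z ^ 13)) := by
  refine ⟨fun f hf => ⟨BoundedTurning.exists_isLogCoeffs hf.1, fun a γ ha hγ =>
    ⟨hγ.eq_taylorCoeff hf.1.1 hf.1.2.1 hf.1.2.2.1 ha, BoundedTurning.norm_logCoeff_le hf hγ⟩⟩,
    fun n hn => ⟨BoundedTurning.extremal_mem_classBT
      (Nat.one_le_iff_ne_zero.1 (Finset.mem_Icc.1 hn).1),
      fun γ hγ => BoundedTurning.norm_logCoeff_extremal hn hγ⟩, ?_⟩
  obtain ⟨b0, b1, b2, b3, b4⟩ := BoundedTurning.taylorCoeff_bean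
  have hpow : ∀ (k : ℕ) (z : ℂ), HasDerivAt (fun z : ℂ => z ^ k) (k * z ^ (k - 1)) z :=
    fun k z => hasDerivAt_pow k z
  refine ⟨?_, ?_, ?_, ?_⟩
  -- Truncating √(1 + tanh) before order m leaves an error of order nm + 1: here 1·5 + 1 = 6, then
  -- 2·4 + 1 = 9, 3·3 + 1 = 10 and 4·3 + 1 = 13.
  · refine BoundedTurning.isBigO_extremal_sub one_ne_zero (BoundedTurning.isBigO_bean_sub 5)
      (by simp) fun z => ?_
    refine (((((hasDerivAt_id' z).add ((hpow 2 z).div_const 4)).sub ((hpow 3 z).div_const 24)).sub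
      (((hpow 4 z).const_mul 5).div_const 192)).add
      (((hpow 5 z).const_mul 17).div_const 1920)).congr_deriv ?_
    simp only [Finset.sum_range_succ, Finset.sum_range_zero, b0, b1, b2, b3, b4]
    norm_num
    ring
  · refine BoundedTurning.isBigO_extremal_sub two_ne_zero (BoundedTurning.isBigO_bean_sub 4)
      (by simp) fun z => ?_
    refine ((((hasDerivAt_id' z).add ((hpow 3 z).div_const 6)).sub ((hpow 5 z).div_const 40)).sub
      (((hpow 7 z).const_mul 5).div_const 336)).congr_deriv ?_
    simp only [Finset.sum_range_succ, Finset.sum_range_zero, b0, b1, b2, b3]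
    norm_num
    ring
  · refine BoundedTurning.isBigO_extremal_sub three_ne_zero (BoundedTurning.isBigO_bean_sub 3)
      (by simp) fun z => ?_
    refine (((hasDerivAt_id' z).add ((hpow 4 z).div_const 8)).sub
      ((hpow 7 z).div_const 56)).congr_deriv ?_
    simp only [Finset.sum_range_succ, Finset.sum_range_zero, b0, b1, b2]
    norm_num
    ring
  · refine BoundedTurning.isBigO_extremal_sub four_ne_zero (BoundedTurning.isBigO_bean_sub 3)
      (by simp) fun z => ?_
    refine (((hasDerivAt_id' z).add ((hpow 5 z).div_const 10)).sub
      ((hpow 9 z).div_const 72)).congr_deriv ?_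
    simp only [Finset.sum_range_succ, Finset.sum_range_zero, b0, b1, b2]
    norm_num
    ring
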